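/- Let $G$ be a finite Dedekind group, i.e. a finite group all of whose subgroups are normal, and let $R$ be a $G$-Tambara functor which is idle: for every subgroup $K \le G$ the Weyl group $\mathrm{Aut}_G(G/K)$ acts trivially on $R(G/K)$. Let $H \le G$ be a subgroup. A Green ideal of $R$ is a levelwise ideal closed under restrictions, transfers and conjugations; a Tambara ideal is a Green ideal $I$ that is also closed under norms (on all finite $G$-sets: $\mathrm{Nm}_f(I(X)) \subseteq \mathrm{Nm}_f(0) + I(Y)$ for every $f : X \to Y$). The product $I \cdot J$ is the Tambara ideal generated by the levelwise products $I(X) \cdot J(X)$. A prime ideal is a proper Tambara ideal $\mathfrak{p}$ such that, for all Tambara ideals $I, J$, $I \cdot J \subseteq \mathfrak{p}$ implies $I \subseteq \mathfrak{p}$ or $J \subseteq \mathfrak{p}$. The Nakaoka spectrum $\mathrm{Spec}(R)$ is the set of prime ideals with the topology whose generating closed sets are $V(I) = \{\mathfrak{p} \mid I \subseteq \mathfrak{p}\}$, $I$ a Tambara ideal. The restriction $\mathrm{Res}_H^G R$ is the $H$-Tambara functor $Y \mapsto R(G \times_H Y)$, and for a Green ideal $I$ of $R$ one puts $(\mathrm{Res}_H^G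 I)(Y) = I(G \times_H Y)$; the coinduction of an $H$-Tambara functor $S$ is $(\mathrm{CoInd}_H^G S)(X) = S(\mathrm{Res}^G_H X)$, and likewise for ideals. The $H$th stratum map $$ s_H : \mathrm{Spec}(\mathrm{Res}_H^G R) \to \mathrm{Spec}(R) $$ sends $\mathfrak{q}$ to the contraction of $\mathrm{CoInd}_H^G \mathfrak{q}$ along the adjunction unit $R \to \mathrm{CoInd}_H^G \mathrm{Res}_H^G R$. Then: 1. $I \mapsto \mathrm{Res}_H^G I$ is an order-preserving map from the Green ideals of $R$ to the Green ideals of $\mathrm{Res}_H^G R$; it sends Tambara ideals to Tambara ideals and prime ideals to prime ideals. 2. $\mathrm{Spec}(\mathrm{Res}_H^G R)$ is a retract of $\mathrm{Spec}(R)$ in the category of topological spaces: the maps $s_H : \mathrm{Spec}(\mathrm{Res}_H^G R) \to \mathrm{Spec}(R)$ and $\mathfrak{p} \mapsto \mathrm{Res}_H^G \mathfrak{p} : \mathrm{Spec}(R) \to \mathrm{Spec}(\mathrm{Res}_H^G R)$ are continuous, and $\mathrm{Res}_H^G(s_H(\mathfrak{q})) = \mathfrak{q}$ for all $\mathfrak{q}$.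 3. In particular the stratum map $s_H$ is injective. -/

import Mathlib

universe u v

/-! ## Finite `G`-sets -/

/-- A finite `G`-set. Morphisms of finite `G`-sets are equivariant maps `X →[G] Y`. -/
structure FinGSet (G : Type u) [Group G] : Type (u + 1) where
  carrier : Type u
  [action : MulAction G carrier]
  [finite : Finite carrier]

namespace FinGSet

instance (G : Type u) [Group G] : CoeSort (FinGSet G) (Type u) := ⟨FinGSet.carrier⟩

attribute [instance] FinGSet.action FinGSet.finite

/-- The commutative square with sides `g' : P → X`, `f' : P → Z`, `f : X → Y`, `g : Z → Y` is a
pullback square. For equivariant maps this says that it is a pullback square of `G`-sets. -/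
def IsPullbackSquare {P X Y Z : Type u} (g' : P → X) (f' : P → Z) (f : X → Y) (g : Z → Y) :
    Prop :=
  (∀ w, f (g' w) = g (f' w)) ∧ ∀ x z, f x = g z → ∃! w, g' w = x ∧ f' w = z

/-- The diagram `X ←p A ←e E →f' P →q Y` is an exponential diagram for `f : X → Y` and `p : A → X`:
`P` is the dependent product of `A` along `f`, i.e. a point of `P` over `y` is the same as a section
of `p` over the fibre of `f` at `y`; `E` is the fibre product of `X` and `P` over `Y`, and `e` is
evaluation of sections. -/
def IsExponentialDiagram {X Y A E P : Type u} (f : X → Y) (p : A → X) (e : E → A) (f' : E → P)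
    (q : P → Y) : Prop :=
  IsPullbackSquare (fun t => p (e t)) f' f q ∧
    ∀ (y : Y) (s : {x : X // f x = y} → A), (∀ x, p (s x) = x) →
      ∃! w : P, q w = y ∧ ∀ t : E, f' t = w → ∀ h : f (p (e t)) = y, e t = s ⟨p (e t), h⟩

end FinGSet

open FinGSet

/-! ## Tambara functors -/

/-- A `G`-Tambara functor, on all finite `G`-sets: restrictions, transfers and norms along
equivariant maps, turning disjoint unions into products, satisfying the base change formulas for
pullback squares and the distributive law for exponential diagrams. -/
structure TambaraFunctor (G : Type u) [Group G] : Type (max (u + 1) (v + 1)) where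
  obj : FinGSet G → Type v
  [commRing : ∀ X, CommRing (obj X)]
  res : ∀ {X Y : FinGSet G}, (X →[G] Y) → (obj Y →+* obj X)
  tr : ∀ {X Y : FinGSet G}, (X →[G] Y) → (obj X →+ obj Y)
  nm : ∀ {X Y : FinGSet G}, (X →[G] Y) → (obj X →* obj Y)
  res_id : ∀ {X : FinGSet G} (a : obj X), res (MulActionHom.id G) a = a
  tr_id : ∀ {X : FinGSet G} (a : obj X), tr (MulActionHom.id G) a = a
  nm_id : ∀ {X : FinGSet G} (a : obj X), nm (MulActionHom.id G) a = a
  res_comp : ∀ {X Y Z : FinGSet G} (g : Y →[G] Z) (f : X →[G] Y) (a : obj Z),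
    res (g.comp f) a = res f (res g a)
  tr_comp : ∀ {X Y Z : FinGSet G} (g : Y →[G] Z) (f : X →[G] Y) (a : obj X),
    tr (g.comp f) a = tr g (tr f a)
  nm_comp : ∀ {X Y Z : FinGSet G} (g : Y →[G] Z) (f : X →[G] Y) (a : obj X),
    nm (g.comp f) a = nm g (nm f a)
  subsingleton_of_isEmpty : ∀ X : FinGSet G, IsEmpty X → Subsingleton (obj X)
  bijective_res_of_coproduct : ∀ {X Y Z : FinGSet G} (i : X →[G] Z) (j : Y →[G] Z),
    Function.Bijective (Sum.elim i j) →
      Function.Bijective (fun a : obj Z => (res i a, res j a))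
  res_tr : ∀ {P X Y Z : FinGSet G} (g' : P →[G] X) (f' : P →[G] Z) (f : X →[G] Y) (g : Z →[G] Y),
    IsPullbackSquare g' f' f g → ∀ a : obj X, res g (tr f a) = tr f' (res g' a)
  res_nm : ∀ {P X Y Z : FinGSet G} (g' : P →[G] X) (f' : P →[G] Z) (f : X →[G] Y) (g : Z →[G] Y),
    IsPullbackSquare g' f' f g → ∀ a : obj X, res g (nm f a) = nm f' (res g' a)
  nm_tr : ∀ {X Y A E P : FinGSet G} (f : X →[G] Y) (p : A →[G] X) (e : E →[G] A) (f' : E →[G] P)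
    (q : P →[G] Y), IsExponentialDiagram f p e f' q →
      ∀ a : obj A, nm f (tr p a) = tr q (nm f' (res e a))

attribute [instance] TambaraFunctor.commRing

/-- A morphism of Tambara functors. -/
structure TambaraHom {G : Type u} [Group G] (R S : TambaraFunctor.{u, v} G) where
  app : ∀ X : FinGSet G, R.obj X →+* S.obj X
  app_res : ∀ {X Y : FinGSet G} (f : X →[G] Y) (a : R.obj Y),
    app X (R.res f a) = S.res f (app Y a)
  app_tr : ∀ {X Y : FinGSet G} (f : X →[G] Y) (a : R.obj X),
    app Y (R.tr f a) = S.tr f (app X a)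
  app_nm : ∀ {X Y : FinGSet G} (f : X →[G] Y) (a : R.obj X),
    app Y (R.nm f a) = S.nm f (app X a)

/-- `R` is idle: for every transitive finite `G`-set `X` (that is, `X ≅ G/K`), the group `Aut(X)`,
i.e. the Weyl group of `K`, acts trivially on `R(X)`. -/
def TambaraFunctor.IsIdle {G : Type u} [Group G] (R : TambaraFunctor.{u, v} G) : Prop :=
  ∀ X : FinGSet G, MulAction.IsPretransitive G X →
    ∀ φ : X →[G] X, Function.Bijective φ → ∀ a : R.obj X, R.res φ a = a

/-- A Dedekind group: all subgroups are normal. -/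
def IsDedekindGroup (G : Type u) [Group G] : Prop := ∀ K : Subgroup G, K.Normal

/-! ## Ideals and the Nakaoka spectrum -/

/-- A Green ideal: a levelwise ideal closed under restrictions and transfers (conjugations are
restrictions along isomorphisms). -/
structure GreenIdeal {G : Type u} [Group G] (R : TambaraFunctor.{u, v} G) where
  carrier : ∀ X : FinGSet G, Ideal (R.obj X)
  res_mem : ∀ {X Y : FinGSet G} (f : X →[G] Y) {a : R.obj Y}, a ∈ carrier Y →
    R.res f a ∈ carrier X
  tr_mem : ∀ {X Y : FinGSet G} (f : X →[G] Y) {a : R.obj X}, a ∈ carrier X →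
    R.tr f a ∈ carrier Y

namespace GreenIdeal

variable {G : Type u} [Group G] {R : TambaraFunctor.{u, v} G}

theorem carrier_injective :
    Function.Injective (GreenIdeal.carrier : GreenIdeal R → ∀ X : FinGSet G, Ideal (R.obj X)) := by
  rintro ⟨I, _, _⟩ ⟨J, _, _⟩ h
  cases h
  rfl

/-- Containment of ideals, level by level. -/
instance : PartialOrder (GreenIdeal R) := PartialOrder.lift GreenIdeal.carrier carrier_injective

/-- A Tambara ideal: a Green ideal `I` such that `Nm_f (I(X)) ⊆ Nm_f (0) + I(Y)` for all
`f : X → Y`. When `f` is surjective, for example when `X` and `Y` are transitive, `Nm_f (0) = 0`. -/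
def IsTambara (I : GreenIdeal R) : Prop :=
  ∀ ⦃X Y : FinGSet G⦄ (f : X →[G] Y) (a : R.obj X), a ∈ I.carrier X →
    R.nm f a - R.nm f 0 ∈ I.carrier Y

/-- The Tambara ideal generated by a set of elements in each level: the intersection of all Tambara
ideals that contain them. -/
def generate (s : ∀ X : FinGSet G, Set (R.obj X)) : GreenIdeal R where
  carrier X := sInf {A | ∃ I : GreenIdeal R, I.IsTambara ∧
    (∀ Y, s Y ⊆ (I.carrier Y : Set (R.obj Y))) ∧ A = I.carrier X}
  res_mem := by
    intro X Y f a ha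
    simp only [Submodule.mem_sInf] at ha ⊢
    rintro _ ⟨I, hI, hs, rfl⟩
    exact I.res_mem f (ha _ ⟨I, hI, hs, rfl⟩)
  tr_mem := by
    intro X Y f a ha
    simp only [Submodule.mem_sInf] at ha ⊢
    rintro _ ⟨I, hI, hs, rfl⟩
    exact I.tr_mem f (ha _ ⟨I, hI, hs, rfl⟩)

theorem generate_isTambara (s : ∀ X : FinGSet G, Set (R.obj X)) :
    (generate s : GreenIdeal R).IsTambara := by
  intro X Y f a ha
  simp only [generate, Submodule.mem_sInf] at ha ⊢
  rintro _ ⟨I, hI, hs, rfl⟩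
  exact hI f a (ha _ ⟨I, hI, hs, rfl⟩)

theorem generate_le {s : ∀ X : FinGSet G, Set (R.obj X)} {I : GreenIdeal R} (hI : I.IsTambara) :
    generate s ≤ I ↔ ∀ X, s X ⊆ (I.carrier X : Set (R.obj X)) := by
  constructor
  · intro h X a ha
    apply h X
    simp only [generate, Submodule.mem_sInf]
    rintro _ ⟨J, hJ, hs, rfl⟩
    exact hs X ha
  · intro h X
    exact sInf_le ⟨I, hI, h, rfl⟩

/-- The product of two ideals: the Tambara ideal generated by the products `a * b` of elements
`a ∈ I(X)`, `b ∈ J(X)`. -/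
instance : Mul (GreenIdeal R) :=
  ⟨fun I J => generate fun X => {c | ∃ a ∈ I.carrier X, ∃ b ∈ J.carrier X, a * b = c}⟩

theorem mul_le_iff {I J K : GreenIdeal R} (hK : K.IsTambara) :
    I * J ≤ K ↔ ∀ X, ∀ a ∈ I.carrier X, ∀ b ∈ J.carrier X, a * b ∈ K.carrier X := by
  refine (generate_le hK).trans (forall_congr' fun X => ?_)
  constructor
  · intro h a ha b hb
    exact h ⟨a, ha, b, hb, rfl⟩
  · rintro h _ ⟨a, ha, b, hb, rfl⟩
    exact h a ha b hb

/-- Prime (Tambara) ideals. As usual, a prime ideal is proper. -/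
structure IsPrime (p : GreenIdeal R) : Prop where
  isTambara : p.IsTambara
  ne_top : ∃ X, p.carrier X ≠ ⊤
  le_or_le : ∀ I J : GreenIdeal R, I.IsTambara → J.IsTambara → I * J ≤ p → I ≤ p ∨ J ≤ p

/-- The contraction of an ideal along a morphism of Tambara functors. -/
def comap {S : TambaraFunctor.{u, v} G} (φ : TambaraHom R S) (I : GreenIdeal S) :
    GreenIdeal R where
  carrier X := (I.carrier X).comap (φ.app X)
  res_mem := by
    intro X Y f a ha
    simp only [Ideal.mem_comap, φ.app_res] at ha ⊢
    exact I.res_mem f ha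
  tr_mem := by
    intro X Y f a ha
    simp only [Ideal.mem_comap, φ.app_tr] at ha ⊢
    exact I.tr_mem f ha

theorem IsTambara.comap {S : TambaraFunctor.{u, v} G} (φ : TambaraHom R S) {I : GreenIdeal S}
    (hI : I.IsTambara) : (I.comap φ).IsTambara := by
  intro X Y f a ha
  simp only [GreenIdeal.comap, Ideal.mem_comap, map_sub, φ.app_nm, map_zero] at ha ⊢
  exact hI f _ ha

end GreenIdeal

/-- The Nakaoka spectrum: the set of prime ideals. -/
def NakaokaSpec {G : Type u} [Group G] (R : TambaraFunctor.{u, v} G) : Type (max (u + 1) v) :=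
  {p : GreenIdeal R // p.IsPrime}

/-- The subset `V(I)` of prime ideals containing `I`. -/
def NakaokaSpec.V {G : Type u} [Group G] {R : TambaraFunctor.{u, v} G} (I : GreenIdeal R) :
    Set (NakaokaSpec R) :=
  {p | I ≤ p.1}

/-- The topology on the Nakaoka spectrum whose generating closed subsets are the `V(I)`, for all
Tambara ideals `I`. -/
instance {G : Type u} [Group G] (R : TambaraFunctor.{u, v} G) :
    TopologicalSpace (NakaokaSpec R) :=
  TopologicalSpace.generateFrom
    {U | ∃ I : GreenIdeal R, I.IsTambara ∧ U = (NakaokaSpec.V I)ᶜ}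

/-! ## Restriction and induction of finite `G`-sets -/

namespace FinGSet

variable {G : Type u} [Group G] (H : Subgroup G)

/-- A finite `G`-set regarded as an `H`-set. -/
def res (X : FinGSet G) : FinGSet H where
  carrier := X.carrier

/-- A `G`-map regarded as an `H`-map. -/
def resMap {X Y : FinGSet G} (f : X →[G] Y) : X.res H →[H] Y.res H where
  toFun := f
  map_smul' h x := f.map_smul (h : G) x

/-- The relation on `G × Y` identifying `(g h, y)` with `(g, h y)` for `h ∈ H`. -/
def indSetoid (Y : FinGSet H) : Setoid (G × Y) where
  r a b := ∃ h : H, a.1 = b.1 * h ∧ b.2 = h • a.2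
  iseqv :=
    { refl := fun a => ⟨1, by simp⟩
      symm := by
        rintro a b ⟨h, h1, h2⟩
        exact ⟨h⁻¹, by simp [h1], by simp [h2]⟩
      trans := by
        rintro a b c ⟨h, h1, h2⟩ ⟨k, k1, k2⟩
        exact ⟨k * h, by simp [h1, k1, mul_assoc], by simp [h2, k2, mul_smul]⟩ }

variable [Finite G]

/-- The induced `G`-set `G ×_H Y`. -/
def ind (Y : FinGSet H) : FinGSet G where
  carrier := Quotient (indSetoid H Y)
  action :=
    { smul := fun g => Quotient.map (fun a => (g * a.1, a.2)) (by
        rintro a b ⟨h, h1, h2⟩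
        exact ⟨h, by simp [h1, mul_assoc], h2⟩)
      one_smul := by
        rintro ⟨g, y⟩
        exact congrArg (Quotient.mk _) (Prod.ext (one_mul g) rfl)
      mul_smul := by
        rintro a b ⟨g, y⟩
        exact congrArg (Quotient.mk _) (Prod.ext (mul_assoc a b g) rfl) }

variable {H}

/-- The class `[g, y]` in `G ×_H Y`. -/
def indMk {Y : FinGSet H} (g : G) (y : Y) : ind H Y := Quotient.mk (indSetoid H Y) (g, y)

theorem indMk_surj {Y : FinGSet H} (z : ind H Y) : ∃ g y, z = indMk g y := by
  obtain ⟨⟨g, y⟩, rfl⟩ := Quotient.exists_rep z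
  exact ⟨g, y, rfl⟩

theorem indMk_eq {Y : FinGSet H} {g g' : G} {y y' : Y} :
    (indMk g y : ind H Y) = indMk g' y' ↔ ∃ h : H, g = g' * h ∧ y' = h • y :=
  Quotient.eq (r := indSetoid H Y)

theorem smul_indMk {Y : FinGSet H} (k g : G) (y : Y) :
    k • (indMk g y : ind H Y) = indMk (k * g) y := rfl

theorem indMk_inj {Y : FinGSet H} {g : G} {y y' : Y} :
    (indMk g y : ind H Y) = indMk g y' ↔ y = y' := by
  rw [indMk_eq]
  constructor
  · rintro ⟨h, h1, h2⟩
    have : h = 1 := by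
      apply Subtype.ext
      simpa using h1
    simp [h2, this]
  · rintro rfl
    exact ⟨1, by simp⟩

variable (H)

/-- The `G`-map `G ×_H f : G ×_H X → G ×_H Y`, `[g, x] ↦ [g, f x]`. -/
def indMap {X Y : FinGSet H} (f : X →[H] Y) : ind H X →[G] ind H Y where
  toFun := Quotient.map (fun a => (a.1, f a.2)) (by
    rintro a b ⟨h, h1, h2⟩
    exact ⟨h, h1, by simp [h2]⟩)
  map_smul' := by
    rintro k ⟨g, x⟩
    rfl

/-- The `G`-map `G ×_H X → X`, `[g, x] ↦ g x`. -/
def indCounit (X : FinGSet G) : ind H (X.res H) →[G] X where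
  toFun := Quotient.lift (fun a : G × X.carrier => a.1 • a.2) (by
    rintro ⟨g, (x : X.carrier)⟩ ⟨g', (x' : X.carrier)⟩ ⟨h, h1, h2⟩
    have h3 : g = g' * h := h1
    have h4 : x' = (h : G) • x := h2
    change g • x = g' • x'
    rw [h3, h4, mul_smul])
  map_smul' := by
    rintro k ⟨g, x⟩
    exact mul_smul (β := X.carrier) k g x

@[simp] theorem indMap_indMk {X Y : FinGSet H} (f : X →[H] Y) (g : G) (x : X) :
    indMap H f (indMk g x) = indMk g (f x) := rfl

@[simp] theorem indCounit_indMk (X : FinGSet G) (g : G) (x : X.carrier) :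
    indCounit H X (indMk (Y := X.res H) g x) = g • x := rfl

theorem indMap_id (X : FinGSet H) :
    indMap H (MulActionHom.id H : X →[H] X) = MulActionHom.id G := by
  ext z
  obtain ⟨g, x, rfl⟩ := indMk_surj z
  rfl

theorem indMap_comp {X Y Z : FinGSet H} (g : Y →[H] Z) (f : X →[H] Y) :
    indMap H (g.comp f) = (indMap H g).comp (indMap H f) := by
  ext z
  obtain ⟨g, x, rfl⟩ := indMk_surj z
  rfl

theorem exists_of_indMap_eq {X Y : FinGSet H} {f : X →[H] Y} {z : ind H X} {g : G} {y : Y}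
    (h : indMap H f z = indMk g y) : ∃ x, z = indMk g x ∧ f x = y := by
  obtain ⟨g', x, rfl⟩ := indMk_surj z
  rw [indMap_indMk, indMk_eq] at h
  obtain ⟨k, h1, h2⟩ := h
  exact ⟨k • x, indMk_eq.2 ⟨k, h1, rfl⟩, by simp [h2]⟩

theorem IsPullbackSquare.ind {P X Y Z : FinGSet H} {g' : P →[H] X} {f' : P →[H] Z} {f : X →[H] Y}
    {g : Z →[H] Y} (h : IsPullbackSquare g' f' f g) :
    IsPullbackSquare (indMap H g') (indMap H f') (indMap H f) (indMap H g) := by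
  constructor
  · intro w
    obtain ⟨k, w, rfl⟩ := indMk_surj w
    simp [h.1]
  · intro x z hxz
    obtain ⟨k, x, rfl⟩ := indMk_surj x
    rw [indMap_indMk] at hxz
    obtain ⟨z, rfl, hz⟩ := exists_of_indMap_eq H hxz.symm
    obtain ⟨w, ⟨hw1, hw2⟩, hw⟩ := h.2 x z hz.symm
    refine ⟨indMk k w, ⟨by simp [hw1], by simp [hw2]⟩, ?_⟩
    rintro w' ⟨h1, h2⟩
    obtain ⟨w', rfl, h3⟩ := exists_of_indMap_eq H h1
    rw [indMap_indMk, indMk_inj] at h2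
    rw [hw w' ⟨h3, h2⟩]

theorem IsExponentialDiagram.ind {X Y A E P : FinGSet H} {f : X →[H] Y} {p : A →[H] X}
    {e : E →[H] A} {f' : E →[H] P} {q : P →[H] Y} (h : IsExponentialDiagram f p e f' q) :
    IsExponentialDiagram (indMap H f) (indMap H p) (indMap H e) (indMap H f') (indMap H q) := by
  constructor
  · have h1 : IsPullbackSquare (p.comp e) f' f q := h.1
    have h2 := IsPullbackSquare.ind H h1
    rw [indMap_comp] at h2
    exact h2
  · intro y s hs
    obtain ⟨k, y, rfl⟩ := indMk_surj y
    have key : ∀ x : {x : X // f x = y},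
        ∃ a : A, s ⟨indMk k x.1, by simp [x.2]⟩ = indMk k a ∧ p a = x.1 :=
      fun x => exists_of_indMap_eq H (hs _)
    choose t ht1 ht2 using key
    obtain ⟨w, ⟨hw1, hw2⟩, hw⟩ := h.2 y t ht2
    refine ⟨indMk k w, ⟨by simp [hw1], ?_⟩, ?_⟩
    · intro c hc hc'
      obtain ⟨c, rfl, hc2⟩ := exists_of_indMap_eq H hc
      simp only [indMap_indMk, indMk_inj] at hc'
      have := hw2 c hc2 hc'
      simp only [indMap_indMk]
      rw [ht1 ⟨p (e c), hc'⟩, ← this]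
    · rintro w' ⟨h1, h2⟩
      obtain ⟨w', rfl, h3⟩ := exists_of_indMap_eq H h1
      rw [hw w' ⟨h3, ?_⟩]
      intro c hc hc'
      have := h2 (indMk k c) (by simp [hc]) (by simp [hc'])
      simp only [indMap_indMk] at this
      rw [ht1 ⟨p (e c), hc'⟩, indMk_inj] at this
      exact this

theorem bijective_sumElim_indMap {X Y Z : FinGSet H} {i : X →[H] Z} {j : Y →[H] Z}
    (h : Function.Bijective (Sum.elim i j)) :
    Function.Bijective (Sum.elim (indMap H i) (indMap H j)) := by
  constructor
  · have aux : ∀ a b : X ⊕ Y, Sum.elim i j a = Sum.elim i j b → a = b := fun a b => @h.1 a b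
    rintro (a | a) (b | b) hab <;> obtain ⟨k, b, rfl⟩ := indMk_surj b <;>
      simp only [Sum.elim_inl, Sum.elim_inr, indMap_indMk] at hab <;>
      obtain ⟨a, rfl, ha⟩ := exists_of_indMap_eq H hab
    · cases aux (Sum.inl a) (Sum.inl b) ha
      rfl
    · cases aux (Sum.inl a) (Sum.inr b) ha
    · cases aux (Sum.inr a) (Sum.inl b) ha
    · cases aux (Sum.inr a) (Sum.inr b) ha
      rfl
  · intro z
    obtain ⟨k, z, rfl⟩ := indMk_surj z
    obtain ⟨x | y, hx⟩ := h.2 z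
    · exact ⟨Sum.inl (indMk k x), by simpa [indMk_inj] using hx⟩
    · exact ⟨Sum.inr (indMk k y), by simpa [indMk_inj] using hx⟩

theorem isPullbackSquare_indCounit {X Y : FinGSet G} (f : X →[G] Y) :
    IsPullbackSquare (indCounit H X) (indMap H (resMap H f)) f (indCounit H Y) := by
  constructor
  · intro w
    obtain ⟨k, w, rfl⟩ := indMk_surj w
    exact f.map_smul k w
  · intro x z hxz
    obtain ⟨k, y, rfl⟩ := indMk_surj z
    replace hxz : f x = k • (show Y from y) := hxz
    have hy : f (k⁻¹ • x) = y := by rw [map_smul, hxz, inv_smul_smul]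
    refine ⟨indMk (Y := X.res H) k (k⁻¹ • x : X), ⟨smul_inv_smul k x, ?_⟩, ?_⟩
    · exact congrArg (indMk (Y := Y.res H) k) hy
    · rintro w ⟨h1, h2⟩
      obtain ⟨w, rfl, hw⟩ := exists_of_indMap_eq H h2
      replace h1 : k • (show X from w) = x := h1
      refine indMk_inj.2 ?_
      rw [← h1, inv_smul_smul]

end FinGSet

/-! ## Restriction and coinduction of Tambara functors -/

namespace TambaraFunctor

variable {G : Type u} [Group G] (H : Subgroup G)

/-- The restriction `Res_H^G R` of a `G`-Tambara functor, `(Res_H^G R)(Y) = R(G ×_H Y)`. In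
particular `(Res_H^G R)(H/L) = R(G/L)`. -/
def restrict [Finite G] (R : TambaraFunctor.{u, v} G) : TambaraFunctor.{u, v} H where
  obj Y := R.obj (ind H Y)
  res f := R.res (indMap H f)
  tr f := R.tr (indMap H f)
  nm f := R.nm (indMap H f)
  res_id a := by rw [indMap_id, R.res_id]
  tr_id a := by rw [indMap_id, R.tr_id]
  nm_id a := by rw [indMap_id, R.nm_id]
  res_comp g f a := by rw [indMap_comp, R.res_comp]
  tr_comp g f a := by rw [indMap_comp, R.tr_comp]
  nm_comp g f a := by rw [indMap_comp, R.nm_comp]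
  subsingleton_of_isEmpty X hX := R.subsingleton_of_isEmpty _ ⟨fun z => by
    obtain ⟨_, x, _⟩ := indMk_surj z
    exact hX.false x⟩
  bijective_res_of_coproduct i j h :=
    R.bijective_res_of_coproduct _ _ (bijective_sumElim_indMap H h)
  res_tr g' f' f g h := R.res_tr _ _ _ _ (IsPullbackSquare.ind H h)
  res_nm g' f' f g h := R.res_nm _ _ _ _ (IsPullbackSquare.ind H h)
  nm_tr f p e f' q h := R.nm_tr _ _ _ _ _ (IsExponentialDiagram.ind H h)

/-- The coinduction `CoInd_H^G S` of an `H`-Tambara functor, `(CoInd_H^G S)(X) = S(Res_H^G X)`. -/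
def coinduce {H : Subgroup G} (S : TambaraFunctor.{u, v} H) : TambaraFunctor.{u, v} G where
  obj X := S.obj (X.res H)
  res f := S.res (resMap H f)
  tr f := S.tr (resMap H f)
  nm f := S.nm (resMap H f)
  res_id a := S.res_id a
  tr_id a := S.tr_id a
  nm_id a := S.nm_id a
  res_comp g f a := S.res_comp (resMap H g) (resMap H f) a
  tr_comp g f a := S.tr_comp (resMap H g) (resMap H f) a
  nm_comp g f a := S.nm_comp (resMap H g) (resMap H f) a
  subsingleton_of_isEmpty X hX := S.subsingleton_of_isEmpty (X.res H) hX
  bijective_res_of_coproduct i j h := S.bijective_res_of_coproduct (resMap H i) (resMap H j) h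
  res_tr g' f' f g h := S.res_tr (resMap H g') (resMap H f') (resMap H f) (resMap H g) h
  res_nm g' f' f g h := S.res_nm (resMap H g') (resMap H f') (resMap H f) (resMap H g) h
  nm_tr f p e f' q h :=
    S.nm_tr (resMap H f) (resMap H p) (resMap H e) (resMap H f') (resMap H q) h

/-- The unit `R → CoInd_H^G Res_H^G R` of the adjunction between restriction and coinduction. At
level `X` it is the restriction `R(X) → R(G ×_H X)` along the action map. -/
def coindUnit [Finite G] (R : TambaraFunctor.{u, v} G) :
    TambaraHom R (coinduce (R.restrict H)) where
  app X := R.res (indCounit H X)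
  app_res {X Y} f a := by
    have h : f.comp (indCounit H X) = (indCounit H Y).comp (indMap H (resMap H f)) :=
      MulActionHom.ext (isPullbackSquare_indCounit H f).1
    change R.res (indCounit H X) (R.res f a) =
      R.res (indMap H (resMap H f)) (R.res (indCounit H Y) a)
    rw [← R.res_comp, ← R.res_comp, h]
  app_tr f a := R.res_tr _ _ _ _ (isPullbackSquare_indCounit H f) a
  app_nm f a := R.res_nm _ _ _ _ (isPullbackSquare_indCounit H f) a

end TambaraFunctor

/-! ## Restriction and coinduction of ideals, and the strata -/

namespace GreenIdeal

variable {G : Type u} [Group G] (H : Subgroup G)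

/-- The restriction `Res_H^G I` of an ideal, `(Res_H^G I)(Y) = I(G ×_H Y)`. In particular
`(Res_H^G I)(H/L) = I(G/L)`. -/
def restrict [Finite G] {R : TambaraFunctor.{u, v} G} (I : GreenIdeal R) :
    GreenIdeal (R.restrict H) where
  carrier Y := I.carrier (ind H Y)
  res_mem f _ ha := I.res_mem (indMap H f) ha
  tr_mem f _ ha := I.tr_mem (indMap H f) ha

/-- The coinduction `CoInd_H^G I` of an ideal, `(CoInd_H^G I)(X) = I(Res_H^G X)`. -/
def coinduce {H : Subgroup G} {S : TambaraFunctor.{u, v} H} (I : GreenIdeal S) :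
    GreenIdeal S.coinduce where
  carrier X := I.carrier (X.res H)
  res_mem f _ ha := I.res_mem (resMap H f) ha
  tr_mem f _ ha := I.tr_mem (resMap H f) ha

theorem IsTambara.restrictIdeal [Finite G] {R : TambaraFunctor.{u, v} G} {I : GreenIdeal R}
    (hI : I.IsTambara) : (I.restrict H).IsTambara :=
  fun _ _ f a ha => hI (indMap H f) a ha

theorem IsTambara.coinduce {H : Subgroup G} {S : TambaraFunctor.{u, v} H} {I : GreenIdeal S}
    (hI : I.IsTambara) : I.coinduce.IsTambara :=
  fun _ _ f a ha => hI (resMap H f) a ha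

end GreenIdeal

namespace NakaokaSpec

variable {G : Type u} [Group G] [Finite G] (H : Subgroup G) (R : TambaraFunctor.{u, v} G)

/-- The `H`-map `Y → G ×_H Y`, `y ↦ [1, y]`. -/
def indInclusion (Y : FinGSet H) : Y →[H] (ind H Y).res H where
  toFun y := indMk 1 y
  map_smul' h y := by
    change indMk 1 (h • y) = indMk ((h : G) * 1) y
    exact (indMk_eq.2 ⟨h, by simp, rfl⟩).symm

theorem isPrime_contract {q : GreenIdeal (R.restrict H)} (hq : q.IsPrime) :
    (q.coinduce.comap (R.coindUnit H)).IsPrime where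
  isTambara := hq.isTambara.coinduce.comap _
  ne_top := by
    obtain ⟨Y, hY⟩ := hq.ne_top
    refine ⟨ind H Y, fun h => hY ?_⟩
    rw [Ideal.eq_top_iff_one] at h ⊢
    have h1 : (1 : (R.restrict H).obj ((ind H Y).res H)) ∈ q.carrier ((ind H Y).res H) := by
      have h2 : (R.coindUnit H).app (ind H Y) 1 ∈ q.carrier ((ind H Y).res H) := h
      rw [map_one] at h2
      exact h2
    have h3 := q.res_mem (indInclusion H Y) h1
    rwa [map_one] at h3
  le_or_le := by
    intro I J hI hJ hIJ
    rw [GreenIdeal.mul_le_iff (hq.isTambara.coinduce.comap _)] at hIJ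
    have key : I.restrict H * J.restrict H ≤ q := by
      rw [GreenIdeal.mul_le_iff hq.isTambara]
      intro Y a ha b hb
      have h1 := q.res_mem (indInclusion H Y) (hIJ (ind H Y) a ha b hb)
      have h2 : (indCounit H (ind H Y)).comp (indMap H (indInclusion H Y)) =
          MulActionHom.id G := by
        ext z
        obtain ⟨g, y, rfl⟩ := indMk_surj z
        change g • (indMk 1 y : ind H Y) = indMk g y
        rw [smul_indMk, mul_one]
      have h3 : (R.restrict H).res (indInclusion H Y)
          (R.res (indCounit H (ind H Y)) (a * b)) = a * b := by
        refine (R.res_comp _ _ _).symm.trans ?_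
        rw [h2]
        exact R.res_id _
      have h4 : (R.restrict H).res (indInclusion H Y)
          (R.res (indCounit H (ind H Y)) (a * b)) ∈ q.carrier Y := h1
      rw [h3] at h4
      exact h4
    refine (hq.le_or_le _ _ (hI.restrictIdeal H) (hJ.restrictIdeal H) key).imp ?_ ?_ <;>
    · intro h X a ha
      exact h (X.res H) (GreenIdeal.res_mem _ (indCounit H X) ha)

/-- The map `Spec(Res_H^G R) ≅ Spec(CoInd_H^G Res_H^G R) → Spec(R)` whose image is the `H`th stratum
of `Spec(R)`: a prime ideal `q` is sent to the contraction of `CoInd_H^G q` along the adjunction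
unit `R → CoInd_H^G Res_H^G R`. -/
def stratumMap (q : NakaokaSpec (R.restrict H)) : NakaokaSpec R :=
  ⟨q.1.coinduce.comap (R.coindUnit H), isPrime_contract H R q.2⟩

end NakaokaSpec

/-! Since all subgroups are normal, the point `[g, y]` of `G ×_H Y` has the same stabilizer as `y`;
in particular stabilizers of points of `G`-sets over `G ×_H Y` lie in `H`. Idleness makes
restriction to a transitive `G`-set insensitive to translating the image of a base point
(`TambaraFunctor.IsIdle.res_eq`).

Together these give `Res (s_H q) = q` for every Green ideal `q` (`restrict_contract`). Membership of
`a ∈ q(Y)` in the contraction is tested on transitive `H`-sets `T → Res (G ×_H Y)`. If `t ↦ [g, y]`,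
then `t ↦ y` defines an `H`-map `T → Y`, and the two resulting maps `G ×_H T → G ×_H Y` differ at
the base point by the translation `g`. So they restrict `a` to the same element, which lies in
`q(T)`.

For primality of `Res p`, let `I * J ≤ Res p` and take `a`, `b` from `I`, `J`, neither in `p`. It is
enough that the principal Tambara ideals of `a` and `b` in `R` have product inside `p`. By the
explicit form of principal ideals and Frobenius reciprocity, this concerns products of two norms, of
restrictions of `a` and of `b`, into a transitive `Z = G/L`. The sources have stabilizers in `H`, so
each norm has a factor passing through `G/(H ∩ L) = G ×_H D`, where `D` is an `H`-orbit in `Z`. The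
two factors are the norms of some `x ∈ I(D)` and `y ∈ J(D)`, so the product is a multiple of the
norm of `x * y`, which lies in `p` (`nm_mul_nm_mem`).

Continuity is formal: on Tambara ideals, `Res` has contraction as right adjoint and `extend` as left
adjoint, so preimages of the sets `V` are again of this form. -/

/-! ## Constructions with finite `G`-sets -/

namespace FinGSet

variable {G : Type u} [Group G]

/-- The empty `G`-set. -/
def empty (G : Type u) [Group G] : FinGSet G where
  carrier := PEmpty
  action := { smul := fun _ x => x, one_smul := fun x => x.elim, mul_smul := fun _ _ x => x.elim }

instance : IsEmpty (empty G) := inferInstanceAs (IsEmpty PEmpty)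

/-- The unique map out of an empty `G`-set. -/
def ofIsEmpty (E : FinGSet G) [IsEmpty E] (X : FinGSet G) : E →[G] X where
  toFun x := isEmptyElim x
  map_smul' _ x := isEmptyElim x

/-- The disjoint union of two finite `G`-sets. -/
def sum (X Y : FinGSet G) : FinGSet G where
  carrier := X.carrier ⊕ Y.carrier

/-- The left inclusion into a disjoint union. -/
def inl (X Y : FinGSet G) : X →[G] sum X Y where
  toFun := Sum.inl
  map_smul' _ _ := rfl

/-- The right inclusion into a disjoint union. -/
def inr (X Y : FinGSet G) : Y →[G] sum X Y where
  toFun := Sum.inr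
  map_smul' _ _ := rfl

/-- The map out of a disjoint union given by maps on the summands. -/
def desc {X Y Z : FinGSet G} (f : X →[G] Z) (g : Y →[G] Z) : sum X Y →[G] Z where
  toFun := Sum.elim f g
  map_smul' := by
    rintro k (x | y)
    · exact f.map_smul k x
    · exact g.map_smul k y

theorem desc_comp_inl {X Y Z : FinGSet G} (f : X →[G] Z) (g : Y →[G] Z) :
    (desc f g).comp (inl X Y) = f := rfl

theorem desc_comp_inr {X Y Z : FinGSet G} (f : X →[G] Z) (g : Y →[G] Z) :
    (desc f g).comp (inr X Y) = g := rfl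

theorem bijective_elim_inl_inr (X Y : FinGSet G) :
    Function.Bijective (Sum.elim (inl X Y) (inr X Y)) := by
  have h : (Sum.elim (inl X Y) (inr X Y) : X.carrier ⊕ Y.carrier → X.carrier ⊕ Y.carrier) = id := by
    funext z
    cases z <;> rfl
  exact h ▸ Function.bijective_id

/-- The disjoint union of two maps. -/
def sumMap {X Y X' Y' : FinGSet G} (f : X →[G] X') (g : Y →[G] Y') : sum X Y →[G] sum X' Y' :=
  desc ((inl X' Y').comp f) ((inr X' Y').comp g)

theorem isPullbackSquare_inl {X Y X' Y' : FinGSet G} (f : X →[G] X') (g : Y →[G] Y') :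
    IsPullbackSquare (inl X Y) f (sumMap f g) (inl X' Y') := by
  refine ⟨fun _ => rfl, ?_⟩
  rintro (x | y) z h
  · exact ⟨x, ⟨rfl, Sum.inl_injective h⟩, fun w hw => Sum.inl_injective hw.1⟩
  · exact absurd h Sum.inr_ne_inl

theorem isPullbackSquare_inr {X Y X' Y' : FinGSet G} (f : X →[G] X') (g : Y →[G] Y') :
    IsPullbackSquare (inr X Y) g (sumMap f g) (inr X' Y') := by
  refine ⟨fun _ => rfl, ?_⟩
  rintro (x | y) z h
  · exact absurd h Sum.inl_ne_inr
  · exact ⟨y, ⟨rfl, Sum.inr_injective h⟩, fun w hw => Sum.inr_injective hw.1⟩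

theorem isPullbackSquare_of_injective {X Y : FinGSet G} {i : X →[G] Y}
    (hi : Function.Injective i) :
    IsPullbackSquare (MulActionHom.id G : X →[G] X) (MulActionHom.id G : X →[G] X) i i :=
  ⟨fun _ => rfl, fun x _ h => ⟨x, ⟨rfl, hi h⟩, fun _ hw => hw.1⟩⟩

theorem isPullbackSquare_of_disjoint {X Y Z : FinGSet G} {f : X →[G] Y} {g : Z →[G] Y}
    (h : ∀ x z, f x ≠ g z) :
    IsPullbackSquare (ofIsEmpty (empty G) X) (ofIsEmpty (empty G) Z) f g :=
  ⟨fun w => isEmptyElim w, fun x z hxz => absurd hxz (h x z)⟩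

theorem IsPullbackSquare.surjective {P X Y Z : Type u} {g' : P → X} {f' : P → Z} {f : X → Y}
    {g : Z → Y} (h : IsPullbackSquare g' f' f g) (hf : Function.Surjective f) :
    Function.Surjective f' := fun z => by
  obtain ⟨x, hx⟩ := hf (g z)
  obtain ⟨w, hw, _⟩ := h.2 x z hx
  exact ⟨w, hw.2⟩

theorem exists_isPullbackSquare {X Y Z : FinGSet G} (f : X →[G] Y) (g : Z →[G] Y) :
    ∃ (P : FinGSet G) (g' : P →[G] X) (f' : P →[G] Z), IsPullbackSquare g' f' f g := by
  let S : SubMulAction G (X.carrier × Z.carrier) :=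
    { carrier := {a | f a.1 = g a.2}
      smul_mem' := fun k a (ha : f a.1 = g a.2) =>
        show f (k • a.1) = g (k • a.2) by rw [map_smul, map_smul, ha] }
  refine ⟨⟨S⟩, ⟨fun a => a.1.1, fun _ _ => rfl⟩, ⟨fun a => a.1.2, fun _ _ => rfl⟩,
    fun a => a.2, fun x z h => ⟨⟨(x, z), h⟩, ⟨rfl, rfl⟩, ?_⟩⟩
  rintro ⟨⟨x', z'⟩, h'⟩ ⟨rfl, rfl⟩
  rfl

open scoped Pointwise in
/-- Dependent products of finite `G`-sets exist; a section over the fibre of `y` is encoded by its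
image in `A`. -/
theorem exists_isExponentialDiagram {X Y A : FinGSet G} (f : X →[G] Y) (p : A →[G] X) :
    ∃ (E P : FinGSet G) (e : E →[G] A) (f' : E →[G] P) (q : P →[G] Y),
      IsExponentialDiagram f p e f' q := by
  let S : SubMulAction G (Y.carrier × Set A.carrier) :=
    { carrier := {w | (∀ a ∈ w.2, f (p a) = w.1) ∧ ∀ x, f x = w.1 → ∃! a, a ∈ w.2 ∧ p a = x}
      smul_mem' := by
        rintro k ⟨y, s⟩ ⟨h1, h2⟩
        refine ⟨?_, ?_⟩
        · rintro _ ⟨a, ha, rfl⟩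
          change f (p (k • a)) = k • y
          rw [map_smul, map_smul, h1 a ha]
        · intro x (hx : f x = k • y)
          obtain ⟨a, ⟨ha, hpa⟩, hu⟩ := h2 (k⁻¹ • x) (by rw [map_smul, hx, inv_smul_smul])
          refine ⟨k • a, ⟨Set.smul_mem_smul_set ha, ?_⟩, ?_⟩
          · rw [map_smul, hpa, smul_inv_smul]
          · rintro _ ⟨⟨b, hb, rfl⟩, hpb⟩
            change p (k • b) = x at hpb
            change k • b = k • a
            rw [hu b ⟨hb, ?_⟩]
            rw [← hpb, map_smul, inv_smul_smul] }
  -- `E` consists of the pairs of a section and a point of its image, which amounts to a section and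
  -- a point of the fibre where it is evaluated.
  let T : SubMulAction G (A.carrier × S) :=
    { carrier := {t | t.1 ∈ t.2.1.2}
      smul_mem' := fun k t (ht : t.1 ∈ t.2.1.2) => Set.smul_mem_smul_set ht }
  refine ⟨⟨T⟩, ⟨S⟩, ⟨fun t => t.1.1, fun _ _ => rfl⟩, ⟨fun t => t.1.2, fun _ _ => rfl⟩,
    ⟨fun w => w.1.1, fun _ _ => rfl⟩, ⟨?_, ?_⟩, ?_⟩
  · rintro ⟨⟨a, w⟩, h⟩
    exact w.2.1 a h
  · intro x w hxw
    obtain ⟨a, ⟨ha, hpa⟩, hu⟩ := w.2.2 x hxw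
    refine ⟨⟨(a, w), ha⟩, ⟨hpa, rfl⟩, ?_⟩
    rintro ⟨⟨b, w'⟩, hb⟩ ⟨h1, rfl⟩
    obtain rfl := hu b ⟨hb, h1⟩
    rfl
  · intro y s hs
    have hmem : (y, Set.range s) ∈ S := by
      refine ⟨?_, ?_⟩
      · rintro _ ⟨x, rfl⟩
        change f (p (s x)) = y
        rw [hs, x.2]
      · intro x hx
        refine ⟨s ⟨x, hx⟩, ⟨⟨_, rfl⟩, hs _⟩, ?_⟩
        rintro _ ⟨⟨x', rfl⟩, hx'⟩
        change p (s x') = x at hx'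
        rw [hs] at hx'
        subst hx'
        rfl
    refine ⟨⟨_, hmem⟩, ⟨rfl, ?_⟩, ?_⟩
    · rintro ⟨⟨a, w⟩, ha⟩ hw h
      change w = _ at hw
      subst hw
      obtain ⟨x, hx⟩ := ha
      change a = s ⟨p a, h⟩
      change s x = a at hx
      subst hx
      congr 1
      exact Subtype.ext (hs x).symm
    · rintro ⟨⟨y', r⟩, hr⟩ ⟨hy, h⟩
      change y' = y at hy
      subst hy
      refine Subtype.ext (Prod.ext rfl (Set.ext fun a => ⟨fun ha => ?_, ?_⟩))
      · exact ⟨_, (h ⟨(a, ⟨(y', r), hr⟩), ha⟩ rfl (hr.1 a ha)).symm⟩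
      · rintro ⟨x, rfl⟩
        obtain ⟨a, ⟨ha, hpa⟩, _⟩ := hr.2 x.1 x.2
        have h3 := h ⟨(a, ⟨(y', r), hr⟩), ha⟩ rfl (hr.1 a ha)
        change a = s ⟨p a, _⟩ at h3
        have h4 : (⟨p a, hr.1 a ha⟩ : {x : X // f x = y'}) = x := Subtype.ext hpa
        rw [h4] at h3
        exact h3 ▸ ha

theorem IsExponentialDiagram.surjective {X Y A E P : Type u} {f : X → Y} {p : A → X} {e : E → A}
    {f' : E → P} {q : P → Y} (h : IsExponentialDiagram f p e f' q) (hf : Function.Surjective f) :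
    Function.Surjective f' :=
  IsPullbackSquare.surjective h.1 hf

/-- Over a nonempty fibre there is no section with values in the empty set, so the dependent product
is empty. -/
theorem isExponentialDiagram_ofIsEmpty {X Y : FinGSet G} {f : X →[G] Y}
    (hf : Function.Surjective f) :
    IsExponentialDiagram f (ofIsEmpty (empty G) X) (MulActionHom.id G : empty G →[G] empty G)
      (MulActionHom.id G : empty G →[G] empty G) (ofIsEmpty (empty G) Y) := by
  refine ⟨⟨fun t => isEmptyElim t, fun _ z => isEmptyElim z⟩, fun y s _ => ?_⟩
  obtain ⟨x, hx⟩ := hf y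
  exact isEmptyElim (s ⟨x, hx⟩)

/-- The exponential diagram behind Frobenius reciprocity. -/
theorem isExponentialDiagram_fold {A X : FinGSet G} (p : A →[G] X) :
    IsExponentialDiagram (desc (MulActionHom.id G) (MulActionHom.id G) : sum X X →[G] X)
      (sumMap p (MulActionHom.id G : X →[G] X)) (sumMap (MulActionHom.id G : A →[G] A) p)
      (desc (MulActionHom.id G) (MulActionHom.id G) : sum A A →[G] A) p := by
  refine ⟨⟨?_, ?_⟩, ?_⟩
  · rintro (a | a) <;> rfl
  · rintro (x | x) a (rfl : x = p a)
    · refine ⟨Sum.inl a, ⟨rfl, rfl⟩, ?_⟩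
      rintro (b | b) ⟨h1, h2⟩
      · exact congrArg Sum.inl h2
      · exact absurd h1 Sum.inr_ne_inl
    · refine ⟨Sum.inr a, ⟨rfl, rfl⟩, ?_⟩
      rintro (b | b) ⟨h1, h2⟩
      · exact absurd h1 Sum.inl_ne_inr
      · exact congrArg Sum.inr h2
  -- A section over the fibre `{inl y, inr y}` respects the summands: on the left it picks a point
  -- of `A` over `y`, on the right it is forced to be `y`. Hence sections over `y` are the points of
  -- `A` over `y`.
  · intro y s hs
    have hl := hs ⟨Sum.inl y, rfl⟩
    have hr := hs ⟨Sum.inr y, rfl⟩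
    rcases hsl : s ⟨Sum.inl y, rfl⟩ with a | x
    · rw [hsl] at hl
      have hpa : p a = y := Sum.inl_injective hl
      rcases hsr : s ⟨Sum.inr y, rfl⟩ with b | x
      · rw [hsr] at hr
        exact absurd hr Sum.inl_ne_inr
      · rw [hsr] at hr
        have hx : x = y := Sum.inr_injective hr
        subst hpa
        subst hx
        refine ⟨a, ⟨rfl, ?_⟩, ?_⟩
        · rintro (b | b) (rfl : b = a) h
          · exact hsl.symm
          · exact hsr.symm
        · rintro b ⟨h1, h2⟩
          have h3 := h2 (Sum.inl b) rfl h1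
          have h4 : ∀ z (h : z = p a), s ⟨Sum.inl z, h⟩ = Sum.inl a := by
            rintro _ rfl
            exact hsl
          exact Sum.inl_injective (h3.trans (h4 _ h1))
    · rw [hsl] at hl
      exact absurd hl Sum.inr_ne_inl

/-! ### Orbits, complements and maps out of transitive `G`-sets. -/

/-- The orbit of a point. -/
def orbit {X : FinGSet G} (x : X) : FinGSet G where
  carrier := MulAction.orbit G x

/-- The inclusion of an orbit. -/
def orbitIncl {X : FinGSet G} (x : X) : orbit x →[G] X where
  toFun := Subtype.val
  map_smul' _ _ := rfl

/-- The base point of an orbit. -/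
def orbitBase {X : FinGSet G} (x : X) : orbit x := ⟨x, MulAction.mem_orbit_self x⟩

instance isPretransitive_orbit {X : FinGSet G} (x : X) :
    MulAction.IsPretransitive G (orbit x) :=
  inferInstanceAs (MulAction.IsPretransitive G (MulAction.orbit G x))

theorem exists_compl {X Y : FinGSet G} {i : X →[G] Y} (hi : Function.Injective i) :
    ∃ (Z : FinGSet G) (j : Z →[G] Y), Function.Bijective (Sum.elim i j) := by
  let S : SubMulAction G Y.carrier :=
    { carrier := (Set.range i)ᶜ
      smul_mem' := by
        rintro k y hy ⟨x, hx⟩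
        exact hy ⟨k⁻¹ • x, by rw [map_smul, hx, inv_smul_smul]⟩ }
  refine ⟨⟨S⟩, ⟨Subtype.val, fun _ _ => rfl⟩, ?_, ?_⟩
  · refine hi.sumElim Subtype.val_injective ?_
    rintro x ⟨y, hy⟩ rfl
    exact hy ⟨x, rfl⟩
  · intro y
    by_cases hy : y ∈ Set.range i
    · obtain ⟨x, rfl⟩ := hy
      exact ⟨Sum.inl x, rfl⟩
    · exact ⟨Sum.inr ⟨y, hy⟩, rfl⟩

theorem exists_image_factorization {X Y : FinGSet G} (f : X →[G] Y) :
    ∃ (Z : FinGSet G) (s : X →[G] Z) (i : Z →[G] Y),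
      Function.Surjective s ∧ Function.Injective i ∧ i.comp s = f := by
  let S : SubMulAction G Y.carrier :=
    { carrier := Set.range f
      smul_mem' := by
        rintro k _ ⟨x, rfl⟩
        exact ⟨k • x, map_smul f k x⟩ }
  refine ⟨⟨S⟩, ⟨fun x => ⟨f x, x, rfl⟩, fun k x => Subtype.ext (map_smul f k x)⟩,
    ⟨Subtype.val, fun _ _ => rfl⟩, ?_, Subtype.val_injective, rfl⟩
  rintro ⟨_, x, rfl⟩
  exact ⟨x, rfl⟩

theorem exists_hom_of_stabilizer_le {X Y : FinGSet G} [MulAction.IsPretransitive G X] (x : X)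
    (y : Y) (h : ∀ g : G, g • x = x → g • y = y) : ∃ f : X →[G] Y, f x = y := by
  have hc : ∀ x' : X, ∃ g : G, g • x = x' := MulAction.exists_smul_eq G x
  choose c hc using hc
  -- The chosen representative of `g • x` differs from `g` by an element of the stabilizer of `x`,
  -- which also fixes `y`.
  have key : ∀ g : G, c (g • x) • y = g • y := fun g => by
    have h1 := h (g⁻¹ * c (g • x)) (by rw [mul_smul, hc, inv_smul_smul])
    rw [mul_smul, inv_smul_eq_iff] at h1
    exact h1
  refine ⟨⟨fun x' => c x' • y, fun k x' => ?_⟩, ?_⟩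
  · obtain ⟨g, rfl⟩ := MulAction.exists_smul_eq G x x'
    rw [key, id, smul_smul, key, smul_smul]
  · change c x • y = y
    simpa using key 1

theorem hom_ext_of_isPretransitive {X Y : FinGSet G} [MulAction.IsPretransitive G X]
    {f f' : X →[G] Y} (x : X) (h : f x = f' x) : f = f' := by
  ext x'
  obtain ⟨g, rfl⟩ := MulAction.exists_smul_eq G x x'
  rw [map_smul, map_smul, h]

theorem surjective_of_isPretransitive {X Y : FinGSet G} [MulAction.IsPretransitive G Y]
    (f : X →[G] Y) (x : X) : Function.Surjective f := fun y => by
  obtain ⟨g, rfl⟩ := MulAction.exists_smul_eq G (f x) y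
  exact ⟨g • x, map_smul f g x⟩

theorem isPretransitive_ind [Finite G] {H : Subgroup G} (Y : FinGSet H)
    [MulAction.IsPretransitive H Y] : MulAction.IsPretransitive G (ind H Y) := by
  constructor
  intro a b
  obtain ⟨g, y, rfl⟩ := indMk_surj a
  obtain ⟨g', y', rfl⟩ := indMk_surj b
  obtain ⟨h, rfl⟩ := MulAction.exists_smul_eq H y y'
  refine ⟨g' * h * g⁻¹, ?_⟩
  rw [smul_indMk, inv_mul_cancel_right]
  exact indMk_eq.2 ⟨h, rfl, rfl⟩

theorem indCounit_surjective [Finite G] (H : Subgroup G) (X : FinGSet G) :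
    Function.Surjective (indCounit H X) := fun x =>
  ⟨indMk (Y := X.res H) 1 x, one_smul G x⟩

end FinGSet

/-! ## Consequences of the axioms of a Tambara functor -/

namespace TambaraFunctor

variable {G : Type u} [Group G] (R : TambaraFunctor.{u, v} G)

theorem ext_of_coproduct {X Y Z : FinGSet G} {i : X →[G] Z} {j : Y →[G] Z}
    (h : Function.Bijective (Sum.elim i j)) {a b : R.obj Z} (hi : R.res i a = R.res i b)
    (hj : R.res j a = R.res j b) : a = b :=
  (R.bijective_res_of_coproduct i j h).1 (Prod.ext hi hj)

theorem exists_res_eq {X Y : FinGSet G} (a : R.obj X) (b : R.obj Y) :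
    ∃ c : R.obj (sum X Y), R.res (inl X Y) c = a ∧ R.res (inr X Y) c = b := by
  obtain ⟨c, hc⟩ := (R.bijective_res_of_coproduct _ _ (bijective_elim_inl_inr X Y)).2 (a, b)
  exact ⟨c, congrArg Prod.fst hc, congrArg Prod.snd hc⟩

theorem res_tr_of_injective {X Y : FinGSet G} {i : X →[G] Y} (hi : Function.Injective i)
    (a : R.obj X) : R.res i (R.tr i a) = a := by
  rw [R.res_tr _ _ _ _ (isPullbackSquare_of_injective hi), R.res_id, R.tr_id]

theorem res_nm_of_injective {X Y : FinGSet G} {i : X →[G] Y} (hi : Function.Injective i)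
    (a : R.obj X) : R.res i (R.nm i a) = a := by
  rw [R.res_nm _ _ _ _ (isPullbackSquare_of_injective hi), R.res_id, R.nm_id]

theorem res_tr_of_disjoint {X Y Z : FinGSet G} {f : X →[G] Y} {g : Z →[G] Y}
    (h : ∀ x z, f x ≠ g z) (a : R.obj X) : R.res g (R.tr f a) = 0 := by
  have := R.subsingleton_of_isEmpty (FinGSet.empty G) inferInstance
  rw [R.res_tr _ _ _ _ (isPullbackSquare_of_disjoint h), Subsingleton.elim (R.res _ a) 0, map_zero]

theorem res_nm_of_disjoint {X Y Z : FinGSet G} {f : X →[G] Y} {g : Z →[G] Y}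
    (h : ∀ x z, f x ≠ g z) (a : R.obj X) : R.res g (R.nm f a) = 1 := by
  have := R.subsingleton_of_isEmpty (FinGSet.empty G) inferInstance
  -- In the zero ring over the empty set every element equals `1`, and norms preserve `1`; this is
  -- why the norm is `1`, not `0`, away from the image.
  rw [R.res_nm _ _ _ _ (isPullbackSquare_of_disjoint h), Subsingleton.elim (R.res _ a) 1, map_one]

section Coproduct

variable {R} {X Y Z : FinGSet G} {i : X →[G] Z} {j : Y →[G] Z}
  (h : Function.Bijective (Sum.elim i j))

include h

theorem _root_.FinGSet.injective_left_of_coproduct : Function.Injective i :=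
  fun _ _ hxy => Sum.inl_injective (h.1 hxy)

theorem _root_.FinGSet.injective_right_of_coproduct : Function.Injective j :=
  fun _ _ hxy => Sum.inr_injective (h.1 hxy)

theorem _root_.FinGSet.ne_of_coproduct (x : X) (y : Y) : i x ≠ j y :=
  fun hxy => Sum.inl_ne_inr (h.1 hxy : Sum.inl x = Sum.inr y)

theorem eq_tr_res_add_tr_res (a : R.obj Z) :
    a = R.tr i (R.res i a) + R.tr j (R.res j a) := by
  refine R.ext_of_coproduct h ?_ ?_
  · rw [map_add, R.res_tr_of_injective (injective_left_of_coproduct h),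
      R.res_tr_of_disjoint fun y x => (ne_of_coproduct h x y).symm, add_zero]
  · rw [map_add, R.res_tr_of_injective (injective_right_of_coproduct h),
      R.res_tr_of_disjoint (ne_of_coproduct h), zero_add]

theorem eq_nm_res_mul_nm_res (a : R.obj Z) :
    a = R.nm i (R.res i a) * R.nm j (R.res j a) := by
  refine R.ext_of_coproduct h ?_ ?_
  · rw [map_mul, R.res_nm_of_injective (injective_left_of_coproduct h),
      R.res_nm_of_disjoint fun y x => (ne_of_coproduct h x y).symm, mul_one]
  · rw [map_mul, R.res_nm_of_injective (injective_right_of_coproduct h),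
      R.res_nm_of_disjoint (ne_of_coproduct h), one_mul]

theorem tr_eq_add_of_coproduct {W : FinGSet G} (f : Z →[G] W) (a : R.obj Z) :
    R.tr f a = R.tr (f.comp i) (R.res i a) + R.tr (f.comp j) (R.res j a) := by
  rw [R.tr_comp, R.tr_comp, ← map_add, ← eq_tr_res_add_tr_res h]

theorem nm_eq_mul_of_coproduct {W : FinGSet G} (f : Z →[G] W) (a : R.obj Z) :
    R.nm f a = R.nm (f.comp i) (R.res i a) * R.nm (f.comp j) (R.res j a) := by
  rw [R.nm_comp, R.nm_comp, ← map_mul, ← eq_nm_res_mul_nm_res h]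

end Coproduct

/-- Zero is a transfer from the empty set, and for surjective `f` the distributive law turns its
norm into another such transfer. -/
theorem nm_zero_of_surjective {X Y : FinGSet G} {f : X →[G] Y} (hf : Function.Surjective f) :
    R.nm f 0 = 0 := by
  have := R.subsingleton_of_isEmpty (FinGSet.empty G) inferInstance
  have h := R.nm_tr _ _ _ _ _ (isExponentialDiagram_ofIsEmpty hf) 0
  rw [map_zero (R.tr _)] at h
  rw [h, ← map_zero (R.tr (ofIsEmpty (FinGSet.empty G) Y))]
  exact congrArg _ (Subsingleton.elim _ _)

/-- Frobenius reciprocity. -/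
theorem tr_mul {A X : FinGSet G} (p : A →[G] X) (a : R.obj A) (b : R.obj X) :
    R.tr p a * b = R.tr p (a * R.res p b) := by
  obtain ⟨c, rfl, rfl⟩ := R.exists_res_eq a b
  -- The norm along the fold map is multiplication, so the distributive law for the fold map is the
  -- claim.
  have h := R.nm_tr _ _ _ _ _ (isExponentialDiagram_fold p) c
  rw [nm_eq_mul_of_coproduct (bijective_elim_inl_inr X X),
    nm_eq_mul_of_coproduct (bijective_elim_inl_inr A A), desc_comp_inl, desc_comp_inr,
    desc_comp_inl, desc_comp_inr, R.nm_id, R.nm_id, R.nm_id, R.nm_id,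
    R.res_tr _ _ _ _ (isPullbackSquare_inl p (MulActionHom.id G)),
    R.res_tr _ _ _ _ (isPullbackSquare_inr p (MulActionHom.id G)), R.tr_id,
    ← R.res_comp, ← R.res_comp] at h
  rw [h, ← R.res_comp]
  congr 2

end TambaraFunctor

/-! ### Membership criteria and principal Tambara ideals. -/

namespace GreenIdeal

variable {G : Type u} [Group G] {R : TambaraFunctor.{u, v} G}

/-- Membership in a Green ideal can be tested on transitive `G`-sets. -/
theorem mem_of_forall_isPretransitive (I : GreenIdeal R) {Z : FinGSet G} {x : R.obj Z}
    (h : ∀ (T : FinGSet G) (f : T →[G] Z), MulAction.IsPretransitive G T → Nonempty T →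
      R.res f x ∈ I.carrier T) : x ∈ I.carrier Z := by
  induction hn : Nat.card Z using Nat.strong_induction_on generalizing Z with
  | _ n ih =>
    rcases isEmpty_or_nonempty Z with hZ | ⟨⟨z⟩⟩
    · have := R.subsingleton_of_isEmpty Z hZ
      rw [Subsingleton.elim x 0]
      exact zero_mem _
    · obtain ⟨W, j, hj⟩ := exists_compl (i := orbitIncl z) Subtype.val_injective
      rw [TambaraFunctor.eq_tr_res_add_tr_res hj x]
      refine add_mem (I.tr_mem _ (h _ _ inferInstance ⟨orbitBase z⟩)) (I.tr_mem _ ?_)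
      refine ih _ ?_ (fun T f hT hT' => ?_) rfl
      · subst hn
        rw [← Nat.card_eq_of_bijective _ hj, Nat.card_sum]
        have : 0 < Nat.card (orbit z) := Nat.card_pos_iff.2 ⟨⟨orbitBase z⟩, inferInstance⟩
        omega
      · rw [← R.res_comp]
        exact h T _ hT hT'

/-- Factor `f` through its image. On the complement of the image both norms are `1` and cancel; on
the image `Nm 0` vanishes and the surjective case applies. -/
theorem isTambara_of_surjective {I : GreenIdeal R}
    (h : ∀ ⦃X Y : FinGSet G⦄ (f : X →[G] Y), Function.Surjective f → ∀ a ∈ I.carrier X,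
      R.nm f a ∈ I.carrier Y) : I.IsTambara := by
  intro X Y f a ha
  obtain ⟨Z, s, i, hs, hi, rfl⟩ := exists_image_factorization f
  obtain ⟨W, j, hj⟩ := exists_compl hi
  rw [R.nm_comp, R.nm_comp, R.nm_zero_of_surjective hs,
    TambaraFunctor.eq_tr_res_add_tr_res hj (_ - _)]
  refine add_mem (I.tr_mem _ ?_) (I.tr_mem _ ?_)
  · rw [map_sub, R.res_nm_of_injective hi, R.res_nm_of_injective hi, sub_zero]
    exact h s hs a ha
  · rw [map_sub, R.res_nm_of_disjoint (ne_of_coproduct hj),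
      R.res_nm_of_disjoint (ne_of_coproduct hj), sub_self]
    exact zero_mem _

theorem IsTambara.nm_mem {I : GreenIdeal R} (hI : I.IsTambara) {X Y : FinGSet G} {f : X →[G] Y}
    (hf : Function.Surjective f) {a : R.obj X} (ha : a ∈ I.carrier X) :
    R.nm f a ∈ I.carrier Y := by
  simpa [R.nm_zero_of_surjective hf] using hI f a ha

/-- The principal Tambara ideal generated by `a`: its elements are the transfers of multiples of
norms of restrictions of `a`. -/
def principal {Y : FinGSet G} (a : R.obj Y) : GreenIdeal R where
  carrier X :=
    -- Surjectivity of `v` is essential: a norm along the map from the empty set is `1`, which would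
    -- make the ideal improper.
    { carrier := {x | ∃ (Z A : FinGSet G) (u : Z →[G] X) (v : A →[G] Z) (w : A →[G] Y)
        (c : R.obj Z), Function.Surjective v ∧ x = R.tr u (c * R.nm v (R.res w a))}
      zero_mem' := by
        have := R.subsingleton_of_isEmpty (FinGSet.empty G) inferInstance
        refine ⟨FinGSet.empty G, FinGSet.empty G, ofIsEmpty _ _, MulActionHom.id G, ofIsEmpty _ _,
          0, Function.surjective_id, ?_⟩
        rw [zero_mul, map_zero]
      add_mem' := by
        rintro _ _ ⟨Z, A, u, v, w, c, hv, rfl⟩ ⟨Z', A', u', v', w', c', hv', rfl⟩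
        obtain ⟨d, rfl, rfl⟩ := R.exists_res_eq c c'
        refine ⟨sum Z Z', sum A A', desc u u', sumMap v v', desc w w', d, hv.sumMap hv', ?_⟩
        rw [TambaraFunctor.tr_eq_add_of_coproduct (bijective_elim_inl_inr Z Z'),
          map_mul (R.res _), map_mul (R.res _),
          R.res_nm _ _ _ _ (isPullbackSquare_inl v v'),
          R.res_nm _ _ _ _ (isPullbackSquare_inr v v'), ← R.res_comp, ← R.res_comp]
        rfl
      smul_mem' := by
        rintro r _ ⟨Z, A, u, v, w, c, hv, rfl⟩
        refine ⟨Z, A, u, v, w, R.res u r * c, hv, ?_⟩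
        rw [smul_eq_mul, mul_comm, R.tr_mul]
        congr 1
        ring }
  res_mem := by
    rintro X X' f _ ⟨Z, A, u, v, w, c, hv, rfl⟩
    obtain ⟨P, g, u', hP⟩ := exists_isPullbackSquare u f
    obtain ⟨Q, k, v', hQ⟩ := exists_isPullbackSquare v g
    refine ⟨P, Q, u', v', w.comp k, R.res g c, hQ.surjective hv, ?_⟩
    rw [R.res_tr _ _ _ _ hP, map_mul, R.res_nm _ _ _ _ hQ, R.res_comp w k]
  tr_mem := by
    rintro X X' f _ ⟨Z, A, u, v, w, c, hv, rfl⟩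
    exact ⟨Z, A, f.comp u, v, w, c, hv, (R.tr_comp _ _ _).symm⟩

/-- The distributive law moves the norm inside the transfer, and base change moves the restriction
inside the inner norm, so the normal form persists. Surjectivity is inherited by pullbacks and
composites. -/
theorem principal_isTambara {Y : FinGSet G} (a : R.obj Y) : (principal a).IsTambara := by
  refine isTambara_of_surjective ?_
  rintro X X' f hf _ ⟨Z, A, u, v, w, c, hv, rfl⟩
  obtain ⟨E, P, e, f', q, hE⟩ := exists_isExponentialDiagram f u
  obtain ⟨Q, k, v', hQ⟩ := exists_isPullbackSquare v e
  refine ⟨P, Q, q, f'.comp v', w.comp k, R.nm f' (R.res e c),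
    (hE.surjective hf).comp (hQ.surjective hv), ?_⟩
  rw [R.nm_tr _ _ _ _ _ hE, map_mul, map_mul, R.res_nm _ _ _ _ hQ, R.nm_comp, R.res_comp w k]

theorem mem_principal {Y : FinGSet G} (a : R.obj Y) : a ∈ (principal a).carrier Y :=
  ⟨Y, Y, MulActionHom.id G, MulActionHom.id G, MulActionHom.id G, 1, Function.surjective_id, by
    rw [one_mul, R.res_id, R.nm_id, R.tr_id]⟩

/-- A product of two principal ideals is contained in a Tambara ideal if all products of norms of
restrictions of the generators, in the transitive levels, are. -/
theorem principal_mul_principal_le {I : GreenIdeal R} (hI : I.IsTambara) {Y Y' : FinGSet G}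
    {a : R.obj Y} {b : R.obj Y'}
    (h : ∀ (Z A B : FinGSet G) (v : A →[G] Z) (w : A →[G] Y) (v' : B →[G] Z) (w' : B →[G] Y'),
      MulAction.IsPretransitive G Z → Nonempty Z → Function.Surjective v →
      Function.Surjective v' → R.nm v (R.res w a) * R.nm v' (R.res w' b) ∈ I.carrier Z) :
    principal a * principal b ≤ I := by
  have h1 : ∀ (Z A B : FinGSet G) (v : A →[G] Z) (w : A →[G] Y) (v' : B →[G] Z) (w' : B →[G] Y'),
      Function.Surjective v → Function.Surjective v' →
      R.nm v (R.res w a) * R.nm v' (R.res w' b) ∈ I.carrier Z := by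
    intro Z A B v w v' w' hv hv'
    refine I.mem_of_forall_isPretransitive fun T f hT hT' => ?_
    obtain ⟨P, k, p, hP⟩ := exists_isPullbackSquare v f
    obtain ⟨Q, l, q, hQ⟩ := exists_isPullbackSquare v' f
    rw [map_mul, R.res_nm _ _ _ _ hP, R.res_nm _ _ _ _ hQ, ← R.res_comp, ← R.res_comp]
    exact h _ _ _ _ _ _ _ hT hT' (hP.surjective hv) (hQ.surjective hv')
  rw [mul_le_iff hI]
  rintro X _ ⟨Z, A, u, v, w, c, hv, rfl⟩ y hy
  rw [R.tr_mul]
  refine I.tr_mem _ ?_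
  -- After the first use of Frobenius reciprocity, the restriction of `y` is again in normal form,
  -- so a second use brings both norms to a common level.
  obtain ⟨Z', B, u', v', w', c', hv', hy'⟩ := (principal b).res_mem u hy
  obtain ⟨P, k, p, hP⟩ := exists_isPullbackSquare v u'
  rw [hy', mul_comm, R.tr_mul, map_mul (R.res _), R.res_nm _ _ _ _ hP, ← R.res_comp]
  refine I.tr_mem _ ?_
  have h2 := h1 _ _ _ _ (w.comp k) _ w' (hP.surjective hv) hv'
  convert Ideal.mul_mem_left _ (c' * R.res u' c) h2 using 1
  ring

end GreenIdeal

/-! ## Dedekind groups and idle Tambara functors -/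

namespace FinGSet

variable {G : Type u} [Group G] {H : Subgroup G}

/-- The stabilizer of `[g, y]` is the conjugate by `g` of the stabilizer of `y` in `H`; the latter
is a subgroup of `G`, hence normal. -/
theorem mem_of_smul_indMk_eq [Finite G] (hG : IsDedekindGroup G) {Y : FinGSet H} {k g : G}
    {y : Y} (h : k • (indMk g y : ind H Y) = indMk g y) : ∃ l : H, (l : G) = k ∧ l • y = y := by
  obtain ⟨l, h1, h2⟩ := indMk_eq.1 h
  let S : Subgroup G := (MulAction.stabilizer H y).map H.subtype
  have hl : (l : G) ∈ S := ⟨l, h2.symm, rfl⟩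
  have hk : k = g * l * g⁻¹ := by rw [← h1, mul_inv_cancel_right]
  obtain ⟨m, hm, hm'⟩ := (hG S).conj_mem _ hl g
  exact ⟨m, hm'.trans hk.symm, hm⟩

/-- The stabilizer of `x` is normal, hence also fixes `k • x`, so `x ↦ k • x` extends to an
equivariant automorphism. -/
theorem exists_comp_eq_of_smul_eq [Finite G] (hG : IsDedekindGroup G) {X Y : FinGSet G}
    [MulAction.IsPretransitive G X] (f f' : X →[G] Y) (x : X) (k : G) (h : k • f' x = f x) :
    ∃ φ : X →[G] X, Function.Bijective φ ∧ f'.comp φ = f := by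
  obtain ⟨φ, hφ⟩ := exists_hom_of_stabilizer_le x (k • x) fun g hg => by
    have hg' : k⁻¹ * g * k⁻¹⁻¹ ∈ MulAction.stabilizer G x := (hG _).conj_mem g hg k⁻¹
    rw [MulAction.mem_stabilizer_iff, mul_smul, mul_smul, inv_smul_eq_iff, inv_inv] at hg'
    exact hg'
  refine ⟨φ, Function.Surjective.bijective_of_finite (surjective_of_isPretransitive φ x),
    hom_ext_of_isPretransitive x ?_⟩
  change f' (φ x) = f x
  rw [hφ, map_smul, h]

end FinGSet

theorem TambaraFunctor.IsIdle.res_eq {G : Type u} [Group G] [Finite G] (hG : IsDedekindGroup G)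
    {R : TambaraFunctor.{u, v} G} (hR : R.IsIdle) {X Y : FinGSet G}
    [hX : MulAction.IsPretransitive G X] (f f' : X →[G] Y) (x : X) (k : G) (h : k • f' x = f x)
    (a : R.obj Y) : R.res f a = R.res f' a := by
  obtain ⟨φ, hφ, rfl⟩ := exists_comp_eq_of_smul_eq hG f f' x k h
  rw [R.res_comp, hR X hX φ hφ]

/-! ### Restriction, contraction and extension of ideals. -/

namespace GreenIdeal

variable {G : Type u} [Group G] [Finite G] {H : Subgroup G} {R : TambaraFunctor.{u, v} G}

/-- The contraction of the coinduction of an ideal along the adjunction unit. -/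
abbrev contract (I : GreenIdeal (R.restrict H)) : GreenIdeal R :=
  I.coinduce.comap (R.coindUnit H)

theorem mem_contract {I : GreenIdeal (R.restrict H)} {X : FinGSet G} {a : R.obj X} :
    a ∈ I.contract.carrier X ↔ R.res (indCounit H X) a ∈ I.carrier (X.res H) :=
  Iff.rfl

theorem restrict_mono {I J : GreenIdeal R} (h : I ≤ J) : I.restrict H ≤ J.restrict H :=
  fun Y => h (ind H Y)

/-- This is the triangle identity of `G ×_H - ⊣ Res`: restricting further along `y ↦ [1, y]`
recovers `a`. Neither idleness nor normality is involved. -/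
theorem restrict_contract_le (I : GreenIdeal (R.restrict H)) : I.contract.restrict H ≤ I := by
  intro Y a ha
  have h1 := I.res_mem (NakaokaSpec.indInclusion H Y) (mem_contract.1 ha)
  have h2 : (indCounit H (ind H Y)).comp (indMap H (NakaokaSpec.indInclusion H Y)) =
      MulActionHom.id G := by
    ext z
    obtain ⟨g, y, rfl⟩ := indMk_surj z
    change g • (indMk 1 y : ind H Y) = indMk g y
    rw [smul_indMk, mul_one]
  have h3 : (R.restrict H).res (NakaokaSpec.indInclusion H Y)
      (R.res (indCounit H (ind H Y)) a) = a := by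
    refine (R.res_comp _ _ _).symm.trans ?_
    rw [h2]
    exact R.res_id _
  exact h3 ▸ h1

theorem restrict_le_iff_le_contract {I : GreenIdeal R} {J : GreenIdeal (R.restrict H)} :
    I.restrict H ≤ J ↔ I ≤ J.contract :=
  ⟨fun h X _ ha => h (X.res H) (I.res_mem (indCounit H X) ha),
    fun h => (restrict_mono h).trans J.restrict_contract_le⟩

/-- For idle Tambara functors over Dedekind groups, restriction is left inverse to contraction. -/
theorem restrict_contract (hG : IsDedekindGroup G) (hR : R.IsIdle)
    (I : GreenIdeal (R.restrict H)) : I.contract.restrict H = I := by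
  refine le_antisymm I.restrict_contract_le fun Y a ha => ?_
  refine mem_contract.2 (I.mem_of_forall_isPretransitive ?_)
  rintro T f hT ⟨t⟩
  obtain ⟨g, y, hgy⟩ := indMk_surj (f t)
  -- The stabilizer of `t` in `H` fixes `f t = [g, y]`, hence fixes `y`.
  obtain ⟨θ, hθ⟩ := exists_hom_of_stabilizer_le t y fun h hh => by
    have h1 : (h : G) • (indMk g y : ind H Y) = indMk g y := by
      have h2 := f.map_smul h t
      rw [hh, hgy] at h2
      exact h2.symm
    obtain ⟨l, hl, hl'⟩ := mem_of_smul_indMk_eq hG h1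
    rwa [Subtype.ext hl] at hl'
  have := isPretransitive_ind T
  -- The two maps send `[1, t]` to `[g, y]` and to `[1, y]`, which differ by the translation `g`.
  have key : R.res ((indCounit H (ind H Y)).comp (indMap H f)) a = R.res (indMap H θ) a := by
    refine hR.res_eq hG _ _ (indMk 1 t) g ?_ a
    change g • (indMk 1 (θ t) : ind H Y) = (1 : G) • (show ind H Y from f t)
    rw [hθ, smul_indMk, mul_one, one_smul]
    exact hgy.symm
  have key' : (R.restrict H).res f (R.res (indCounit H (ind H Y)) a) = (R.restrict H).res θ a :=
    (R.res_comp _ _ _).symm.trans key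
  exact key' ▸ I.res_mem θ ha

/-- Norms of elements of `I.contract` and `J.contract` from `G`-sets over `G/H` factor through
a common induced `G`-set. -/
theorem nm_mul_nm_mem (hG : IsDedekindGroup G) (hR : R.IsIdle)
    {I J : GreenIdeal (R.restrict H)} (hI : I.IsTambara) (hJ : J.IsTambara) {p : GreenIdeal R}
    (hp : p.IsTambara) (h : I * J ≤ p.restrict H) {Y Y' : FinGSet H} {Z A B : FinGSet G}
    [MulAction.IsPretransitive G Z] [Nonempty Z] {v : A →[G] Z} (hv : Function.Surjective v)
    (w : A →[G] ind H Y) {v' : B →[G] Z} (hv' : Function.Surjective v') (w' : B →[G] ind H Y')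
    {a : R.obj A} (ha : a ∈ I.contract.carrier A) {b : R.obj B}
    (hb : b ∈ J.contract.carrier B) : R.nm v a * R.nm v' b ∈ p.carrier Z := by
  obtain ⟨z⟩ := ‹Nonempty Z›
  -- If `Z = G/L` with base point `z`, then `D = H/(H ∩ L)` and `G ×_H D = G/(H ∩ L)`. It depends
  -- only on `Z`, so it serves both norms.
  let D : FinGSet H := orbit (X := Z.res H) z
  have : MulAction.IsPretransitive H D :=
    isPretransitive_orbit (X := Z.res H) z
  have hD : MulAction.IsPretransitive G (ind H D) := isPretransitive_ind D
  let δ : ind H D →[G] Z := (indCounit H Z).comp (indMap H (orbitIncl (X := Z.res H) z))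
  let d : ind H D := indMk 1 (orbitBase (X := Z.res H) z)
  have hd : δ d = z := one_smul G z
  have hδ : Function.Surjective δ := surjective_of_isPretransitive δ d
  have factor : ∀ {K : GreenIdeal (R.restrict H)} (_ : K.IsTambara) {W : FinGSet H}
      {C : FinGSet G} {f : C →[G] Z} (_ : Function.Surjective f) (_ : C →[G] ind H W)
      {c : R.obj C} (_ : c ∈ K.contract.carrier C),
      ∃ x : R.obj (ind H D), x ∈ K.carrier D ∧ ∃ r, R.nm f c = R.nm δ x * r := by
    intro K hK W C f hf e c hc
    obtain ⟨c₀, hc₀⟩ := hf z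
    obtain ⟨C', j, hj⟩ := exists_compl (i := orbitIncl c₀) Subtype.val_injective
    -- The map to `G ×_H W` forces the stabilizer of `c₀` into `H`, and `f c₀ = z` forces it into
    -- the stabilizer of `z`; together these fix `d`.
    have hstab : ∀ k : G, k • orbitBase c₀ = orbitBase c₀ → k • d = d := by
      intro k hk
      have hk' : k • c₀ = c₀ := congrArg Subtype.val hk
      obtain ⟨g, y, hgy⟩ := indMk_surj (e c₀)
      obtain ⟨l, rfl, -⟩ := mem_of_smul_indMk_eq hG (k := k) (g := g) (y := y) (by
        rw [← hgy, ← map_smul, hk'])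
      have hz : (l : G) • z = z := by rw [← hc₀, ← map_smul, hk']
      change (indMk ((l : G) * 1) _ : ind H D) = indMk 1 _
      exact indMk_eq.2 ⟨l, by simp, Subtype.ext hz.symm⟩
    obtain ⟨s, hs⟩ := exists_hom_of_stabilizer_le (orbitBase c₀) d hstab
    have hfac : f.comp (orbitIncl c₀) = δ.comp s := by
      refine hom_ext_of_isPretransitive (orbitBase c₀) ?_
      change f c₀ = δ (s _)
      rw [hs, hd, hc₀]
    -- Only the orbit of `c₀` is needed to put the norm in the ideal; the other orbits of `C`
    -- contribute the cofactor.
    refine ⟨R.nm s (R.res (orbitIncl c₀) c), ?_, R.nm (f.comp j) (R.res j c), ?_⟩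
    · have h1 : R.nm s (R.res (orbitIncl c₀) c) ∈ (K.contract.restrict H).carrier D :=
        (hK.coinduce.comap (R.coindUnit H)).nm_mem
          (surjective_of_isPretransitive s (orbitBase c₀)) (K.contract.res_mem _ hc)
      rwa [restrict_contract hG hR] at h1
    · rw [TambaraFunctor.nm_eq_mul_of_coproduct hj, hfac, R.nm_comp]
  obtain ⟨x, hx, r, hr⟩ := factor hI hv w ha
  obtain ⟨y, hy, t, ht⟩ := factor hJ hv' w' hb
  have hxy : x * y ∈ p.carrier (ind H D) :=
    (mul_le_iff (hp.restrictIdeal H)).1 h D x hx y hy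
  rw [hr, ht, mul_mul_mul_comm, ← map_mul]
  exact Ideal.mul_mem_right _ _ (hp.nm_mem hδ hxy)

/-- Elements of `I` and `J` outside `p` generate principal ideals of `R` whose product is in `p`,
contradicting primality of `p`. -/
theorem IsPrime.restrict (hG : IsDedekindGroup G) (hR : R.IsIdle) {p : GreenIdeal R}
    (hp : p.IsPrime) : (p.restrict H).IsPrime where
  isTambara := hp.isTambara.restrictIdeal H
  ne_top := by
    obtain ⟨X, hX⟩ := hp.ne_top
    -- If `1` lies in `p` at level `G ×_H X`, so does its norm, again `1`, at level `X`.
    refine ⟨X.res H, fun h => hX ?_⟩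
    have h1 : (1 : R.obj (ind H (X.res H))) ∈ p.carrier (ind H (X.res H)) :=
      (Ideal.eq_top_iff_one _).1 h
    have h2 := hp.isTambara.nm_mem (indCounit_surjective H X) h1
    rw [map_one] at h2
    exact (Ideal.eq_top_iff_one _).2 h2
  le_or_le := by
    intro I J hI hJ hIJ
    by_contra hcon
    rw [not_or] at hcon
    obtain ⟨hIp, hJp⟩ := hcon
    have witness : ∀ {K : GreenIdeal (R.restrict H)}, ¬ K ≤ p.restrict H →
        ∃ Y, ∃ a : R.obj (ind H Y), a ∈ K.contract.carrier (ind H Y) ∧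
          a ∉ p.carrier (ind H Y) := by
      intro K hK
      obtain ⟨Y, hY⟩ := not_forall.1 hK
      obtain ⟨a, ha, hap⟩ := SetLike.not_le_iff_exists.1 hY
      refine ⟨Y, a, ?_, hap⟩
      -- Membership is rephrased through the contraction because that is an ideal of `R`, closed
      -- under restriction along all `G`-maps.
      rw [← restrict_contract hG hR K] at ha
      exact ha
    obtain ⟨Y, a, ha, hap⟩ := witness hIp
    obtain ⟨Y', b, hb, hbp⟩ := witness hJp
    have hle : principal a * principal b ≤ p :=
      principal_mul_principal_le hp.isTambara fun Z A B v w v' w' _ _ hv hv' =>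
        nm_mul_nm_mem hG hR hI hJ hp.isTambara hIJ hv w hv' w' (I.contract.res_mem w ha)
          (J.contract.res_mem w' hb)
    rcases hp.le_or_le _ _ (principal_isTambara a) (principal_isTambara b) hle with h | h
    · exact hap (h _ (mem_principal a))
    · exact hbp (h _ (mem_principal b))

/-- The Tambara ideal of `R` generated by an ideal of `R.restrict H`. -/
def extend (J : GreenIdeal (R.restrict H)) : GreenIdeal R :=
  -- Generators are needed at every level `X`; allowing restrictions along `f` avoids an equality `X
  -- = G ×_H Y` and does not enlarge the ideal.
  generate fun X => {a | ∃ (Y : FinGSet H) (f : X →[G] ind H Y), ∃ b ∈ J.carrier Y, a = R.res f b}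

theorem extend_le_iff {J : GreenIdeal (R.restrict H)} {I : GreenIdeal R} (hI : I.IsTambara) :
    J.extend ≤ I ↔ J ≤ I.restrict H := by
  refine (generate_le hI).trans ⟨fun h Y b hb => ?_, ?_⟩
  · exact h _ ⟨Y, MulActionHom.id G, b, hb, (R.res_id b).symm⟩
  · rintro h X _ ⟨Y, f, b, hb, rfl⟩
    exact I.res_mem f (h Y hb)

end GreenIdeal

/-! ### Continuity and the retraction. -/

namespace NakaokaSpec

variable {G : Type u} [Group G] [Finite G] (H : Subgroup G) (R : TambaraFunctor.{u, v} G)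

theorem continuous_stratumMap : Continuous (stratumMap H R) := by
  refine continuous_generateFrom_iff.2 ?_
  rintro _ ⟨I, hI, rfl⟩
  refine TopologicalSpace.isOpen_generateFrom_of_mem ⟨I.restrict H, hI.restrictIdeal H, ?_⟩
  ext q
  exact not_congr GreenIdeal.restrict_le_iff_le_contract.symm

variable {H R}

/-- The restriction of prime ideals. -/
def restrict (hG : IsDedekindGroup G) (hR : R.IsIdle) (p : NakaokaSpec R) :
    NakaokaSpec (R.restrict H) :=
  ⟨p.1.restrict H, p.2.restrict hG hR⟩

theorem continuous_restrict (hG : IsDedekindGroup G) (hR : R.IsIdle) :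
    Continuous (restrict (H := H) hG hR) := by
  refine continuous_generateFrom_iff.2 ?_
  rintro _ ⟨J, hJ, rfl⟩
  refine TopologicalSpace.isOpen_generateFrom_of_mem
    ⟨J.extend, GreenIdeal.generate_isTambara _, ?_⟩
  ext p
  exact not_congr (GreenIdeal.extend_le_iff p.2.isTambara).symm

theorem restrict_stratumMap (hG : IsDedekindGroup G) (hR : R.IsIdle)
    (q : NakaokaSpec (R.restrict H)) : restrict hG hR (stratumMap H R q) = q :=
  Subtype.ext (GreenIdeal.restrict_contract hG hR q.1)

end NakaokaSpec

theorem mainTheorem11 {G : Type u} [Group G] [Finite G] (hG : IsDedekindGroup G)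
    (R : TambaraFunctor.{u, v} G) (hR : R.IsIdle) (H : Subgroup G) :
    Monotone (fun I : GreenIdeal R => I.restrict H) ∧
    (∀ I : GreenIdeal R, I.IsTambara → (I.restrict H).IsTambara) ∧
    (∀ p : GreenIdeal R, p.IsPrime → (p.restrict H).IsPrime) ∧
    (∃ ρ : CategoryTheory.Retract (TopCat.of (NakaokaSpec (R.restrict H)))
        (TopCat.of (NakaokaSpec R)),
      (∀ q : NakaokaSpec (R.restrict H), ρ.i.hom q = NakaokaSpec.stratumMap H R q) ∧
      (∀ p : NakaokaSpec R, (ρ.r.hom p : NakaokaSpec (R.restrict H)).1 = p.1.restrict H)) ∧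
    Function.Injective (NakaokaSpec.stratumMap H R) := by
  refine ⟨fun _ _ => GreenIdeal.restrict_mono, fun _ hI => hI.restrictIdeal H,
    fun _ hp => hp.restrict hG hR, ⟨{
      i := TopCat.ofHom ⟨_, NakaokaSpec.continuous_stratumMap H R⟩
      r := TopCat.ofHom ⟨_, NakaokaSpec.continuous_restrict hG hR⟩
      retract := ?_ }, fun _ => rfl, fun _ => rfl⟩, ?_⟩
  · ext q
    exact NakaokaSpec.restrict_stratumMap hG hR q
  · exact Function.LeftInverse.injective (NakaokaSpec.restrict_stratumMap hG hR)
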